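/- A set $S\subset\mathbb{R}^d$ is a 2-distance set if the set of distances $\|p-q\|$ between distinct points $p,q\in S$ has exactly two elements $\alpha_1>\alpha_2$. Its associated graph has vertex set $S$, with two points adjacent if and only if their distance is the larger value $\alpha_1$. A graph $G$ has a spherical representation in $\mathbb{R}^d$ if $G$ is isomorphic to the associated graph of some 2-distance set $S\subset\mathbb{R}^d$ all of whose points lie on a common $(d-1)$-dimensional sphere in $\mathbb{R}^d$. Corollary. Let $d$ be a positive integer and let $G$ be a (finite, simple) regular graph on $d+2$ vertices that is not complete multipartite. Then $G$ has a spherical representation in $\mathbb{R}^d$. (Edgeless graphs and complete graphs count as complete multipartite.) -/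

import Mathlib

/-- The set of distances between distinct points of a set `S` of points of `ℝ^d`. -/
def distanceSet {d : ℕ} (S : Set (EuclideanSpace ℝ (Fin d))) : Set ℝ :=
  {r | ∃ p ∈ S, ∃ q ∈ S, p ≠ q ∧ r = dist p q}

/-- A 2-distance set: exactly two distances occur between distinct points of `S`. -/
def IsTwoDistanceSet {d : ℕ} (S : Set (EuclideanSpace ℝ (Fin d))) : Prop :=
  (distanceSet S).ncard = 2

/-- The associated graph of a 2-distance set `S`: the vertices are the points of `S`, and two
points are adjacent exactly when their distance is the larger of the two distances. -/
def associatedGraph {d : ℕ} (S : Set (EuclideanSpace ℝ (Fin d))) : SimpleGraph S where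
  Adj p q := p ≠ q ∧ IsGreatest (distanceSet S) (dist (p : EuclideanSpace ℝ (Fin d)) q)
  symm := ⟨fun p q h => ⟨h.1.symm, by rw [dist_comm]; exact h.2⟩⟩
  loopless := ⟨fun _ h => h.1 rfl⟩

/-- All points of `S` lie on a common `(d-1)`-dimensional sphere (of positive radius) in `ℝ^d`. -/
def LiesOnSphere {d : ℕ} (S : Set (EuclideanSpace ℝ (Fin d))) : Prop :=
  ∃ (c : EuclideanSpace ℝ (Fin d)) (r : ℝ), 0 < r ∧ S ⊆ Metric.sphere c r

/-- `G` has a spherical representation in `ℝ^d`: it is (isomorphic to) the associated graph of a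
spherical 2-distance set in `ℝ^d`. -/
def HasSphericalRepresentation {V : Type*} (G : SimpleGraph V) (d : ℕ) : Prop :=
  ∃ S : Set (EuclideanSpace ℝ (Fin d)),
    IsTwoDistanceSet S ∧ LiesOnSphere S ∧ Nonempty (G ≃g associatedGraph S)

/-!
Let `A` be the adjacency matrix of `G`, which is regular of degree `r` on `n = d + 2` vertices, and
let `θ` be the maximum of the Rayleigh quotient of `A` on the vectors whose coordinates sum to zero.
As `G` is not complete multipartite, there are `x`, `y`, `z` with `x` adjacent to `z` and `y`
adjacent to neither; the vector `e_x + e_z - 2 e_y` has coordinate sum zero and value `2` under the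
quadratic form of `A`, so `θ > 0`.

Consider `M = θ I - A + ((r - θ) / n) J`, with `J` the all-ones matrix (`shiftedAdjMatrix`). By
regularity, the value of its quadratic form at a vector depends only on the projection of that
vector to the sum-zero hyperplane, where it is nonnegative by the choice of `θ`. Hence `M` is
positive semidefinite, and its kernel contains both the all-ones vector and a maximizer of the
Rayleigh quotient, so its rank is at most `n - 2 = d`. Therefore `M` is the Gram matrix of vectors
in `ℝ^d` (`Matrix.PosSemidef.exists_inner_eq`). The diagonal of `M` is constant, so these vectors
lie on a sphere about the origin, and their squared mutual distances are `2θ + 2` for adjacent and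
`2θ` for distinct non-adjacent vertices; as `θ > 0`, distinct vertices have distinct images.
-/

open Matrix

/-! ### Gram representations -/

/-- A positive semidefinite real matrix of rank at most `d` is a Gram matrix of vectors in `ℝ^d`:
writing `M = Bᴴ * B`, the columns of `B` span a space of dimension `rank B = rank M`, which
embeds isometrically in `ℝ^d`. -/
theorem Matrix.PosSemidef.exists_inner_eq {V : Type*} [Fintype V] {M : Matrix V V ℝ}
    (hM : M.PosSemidef) {d : ℕ} (hd : M.rank ≤ d) :
    ∃ f : V → EuclideanSpace ℝ (Fin d), ∀ i j, inner ℝ (f i) (f j) = M i j := by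
  classical
  obtain ⟨B, rfl⟩ := by
    open scoped MatrixOrder in
    exact CStarAlgebra.nonneg_iff_eq_star_mul_self.mp hM.nonneg
  let c : V → EuclideanSpace ℝ V := fun j => WithLp.toLp 2 (B.col j)
  let W : Submodule ℝ (EuclideanSpace ℝ V) := Submodule.span ℝ (Set.range c)
  have hW : Module.finrank ℝ W ≤ d := by
    rw [star_eq_conjTranspose, Matrix.rank_conjTranspose_mul_self,
      Matrix.rank_eq_finrank_span_cols] at hd
    have : W = (Submodule.span ℝ (Set.range B.col)).map
        (WithLp.linearEquiv 2 ℝ (V → ℝ)).symm.toLinearMap := by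
      rw [Submodule.map_span, ← Set.range_comp]
      rfl
    rw [this, LinearEquiv.finrank_map_eq]
    exact hd
  let b := stdOrthonormalBasis ℝ W
  let g : W →ₗ[ℝ] EuclideanSpace ℝ (Fin d) :=
    b.toBasis.constr ℝ (fun i => EuclideanSpace.single (Fin.castLE hW i) (1 : ℝ))
  have hb : Orthonormal ℝ b.toBasis := by
    simp [b.orthonormal]
  have hg : Orthonormal ℝ (g ∘ b.toBasis) := by
    have : g ∘ b.toBasis = fun i => EuclideanSpace.single (Fin.castLE hW i) (1 : ℝ) := by
      funext i
      exact b.toBasis.constr_basis ℝ _ i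
    rw [this]
    exact (EuclideanSpace.orthonormal_single (𝕜 := ℝ) (ι := Fin d)).comp _
      (Fin.castLE_injective hW)
  let φ := g.isometryOfOrthonormal hb hg
  refine ⟨fun i => φ ⟨c i, Submodule.subset_span ⟨i, rfl⟩⟩, fun i j => ?_⟩
  rw [φ.inner_map_map, Submodule.coe_inner, EuclideanSpace.inner_eq_star_dotProduct]
  simp [c, Matrix.mul_apply, dotProduct, Matrix.star_eq_conjTranspose, mul_comm]

/-- Two linearly independent kernel vectors bring the rank of a square matrix down by two. -/
theorem Matrix.rank_add_two_le {V : Type*} [Fintype V] {M : Matrix V V ℝ} {x y : V → ℝ}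
    (hxy : LinearIndependent ℝ ![x, y]) (hx : M *ᵥ x = 0) (hy : M *ᵥ y = 0) :
    M.rank + 2 ≤ Fintype.card V := by
  have h := M.mulVecLin.finrank_range_add_finrank_ker
  rw [Module.finrank_fintype_fun_eq_card] at h
  have hle : Submodule.span ℝ (Set.range ![x, y]) ≤ LinearMap.ker M.mulVecLin := by
    rw [Submodule.span_le]
    rintro _ ⟨i, rfl⟩
    fin_cases i
    · simpa using hx
    · simpa using hy
  have h2 := Submodule.finrank_mono hle
  rw [finrank_span_eq_card hxy, Fintype.card_fin] at h2
  rw [Matrix.rank]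
  omega

/-! ### The largest Rayleigh quotient on the sum-zero hyperplane -/

/-- The Rayleigh quotient of `A` attains its maximum over the nonzero vectors of coordinate sum
zero; the quotient is normalized by taking the maximizer of norm one. -/
theorem Matrix.exists_isMax_rayleigh_sum_eq_zero {V : Type*} [Fintype V] (A : Matrix V V ℝ)
    {w : V → ℝ} (hw : ∑ i, w i = 0) (hw0 : w ≠ 0) :
    ∃ v : V → ℝ, ∑ i, v i = 0 ∧ v ⬝ᵥ v = 1 ∧
      ∀ u : V → ℝ, ∑ i, u i = 0 → u ⬝ᵥ A *ᵥ u ≤ (v ⬝ᵥ A *ᵥ v) * (u ⬝ᵥ u) := by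
  have normalize : ∀ u : V → ℝ, u ≠ 0 → ∑ i, u i = 0 →
      ∃ t : ℝ, t ^ 2 * (u ⬝ᵥ u) = 1 ∧ ∑ i, (t • u) i = 0 ∧ (t • u) ⬝ᵥ (t • u) = 1 := by
    intro u hu hsum
    have hpos : 0 < u ⬝ᵥ u := by simpa using Matrix.dotProduct_star_self_pos_iff.mpr hu
    have ht : (Real.sqrt (u ⬝ᵥ u))⁻¹ ^ 2 * (u ⬝ᵥ u) = 1 := by
      rw [inv_pow, Real.sq_sqrt hpos.le, inv_mul_cancel₀ hpos.ne']
    refine ⟨(Real.sqrt (u ⬝ᵥ u))⁻¹, ht, ?_, ?_⟩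
    · simp [← Finset.mul_sum, hsum]
    · rw [smul_dotProduct, dotProduct_smul, smul_eq_mul, smul_eq_mul, ← mul_assoc, ← sq, ht]
  let K : Set (V → ℝ) := {u | ∑ i, u i = 0 ∧ u ⬝ᵥ u = 1}
  have hclosed : IsClosed K :=
    (isClosed_eq (by fun_prop) continuous_const).inter
      (isClosed_eq (by unfold dotProduct; fun_prop) continuous_const)
  have hbdd : Bornology.IsBounded K := by
    refine (Metric.isBounded_closedBall (x := (0 : V → ℝ)) (r := 1)).subset fun u hu => ?_
    rw [mem_closedBall_zero_iff, pi_norm_le_iff_of_nonneg zero_le_one]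
    intro i
    have h1 : u i * u i ≤ u ⬝ᵥ u :=
      Finset.single_le_sum (f := fun i => u i * u i) (fun j _ => mul_self_nonneg (u j))
        (Finset.mem_univ i)
    rw [hu.2] at h1
    rw [Real.norm_eq_abs, ← sq_le_one_iff_abs_le_one, sq]
    exact h1
  obtain ⟨t, -, ht⟩ := normalize w hw0 hw
  obtain ⟨v, hv, hmax⟩ := (Metric.isCompact_of_isClosed_isBounded hclosed hbdd).exists_isMaxOn
    ⟨t • w, ht⟩ (f := fun u => u ⬝ᵥ A *ᵥ u)
    (by unfold Matrix.mulVec dotProduct; fun_prop)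
  refine ⟨v, hv.1, hv.2, fun u hu => ?_⟩
  rcases eq_or_ne u 0 with rfl | hu0
  · simp
  obtain ⟨s, hs, hsK⟩ := normalize u hu0 hu
  have h := hmax hsK
  simp only [Set.mem_ofPred_eq, mulVec_smul, smul_dotProduct, dotProduct_smul, smul_eq_mul] at h
  have hpos : 0 < u ⬝ᵥ u := by simpa using Matrix.dotProduct_star_self_pos_iff.mpr hu0
  calc u ⬝ᵥ A *ᵥ u = (s * (s * (u ⬝ᵥ A *ᵥ u))) * (u ⬝ᵥ u) := by
        linear_combination (-(u ⬝ᵥ A *ᵥ u)) * hs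
    _ ≤ _ := mul_le_mul_of_nonneg_right h hpos.le

namespace SimpleGraph

variable {V : Type*} [Fintype V] [DecidableEq V] (G : SimpleGraph V) [DecidableRel G.Adj]

/-- If `G` is not complete multipartite, its adjacency form is positive at some vector of
coordinate sum zero. -/
theorem exists_sum_eq_zero_adjMatrix_pos (hG : ¬ G.IsCompleteMultipartite) :
    ∃ w : V → ℝ, ∑ i, w i = 0 ∧ 0 < w ⬝ᵥ G.adjMatrix ℝ *ᵥ w := by
  obtain ⟨x, y, z, hxy, hyz, hxz⟩ :
      ∃ x y z, ¬ G.Adj x y ∧ ¬ G.Adj y z ∧ G.Adj x z := by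
    by_contra! h
    exact hG ⟨fun x y z h1 h2 => h x y z h1 h2⟩
  refine ⟨Pi.single x 1 + Pi.single z 1 - Pi.single y 2, ?_, ?_⟩
  · simp [Finset.sum_add_distrib]
    norm_num
  · have hyx : ¬ G.Adj y x := fun h => hxy (G.adj_symm h)
    have hzy : ¬ G.Adj z y := fun h => hyz (G.adj_symm h)
    have hzx := G.adj_symm hxz
    simp [mulVec_add, mulVec_sub, add_dotProduct, sub_dotProduct, dotProduct_add, dotProduct_sub,
      hxy, hyz, hxz, hyx, hzy, hzx]

/-! ### The Gram matrix of the representation -/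

/-- The matrix `θ I - A + ((r - θ) / n) J`, with `A` the adjacency matrix of a graph on `n` vertices
and `J` the all-ones matrix. For an `r`-regular graph it annihilates the all-ones vector and agrees
with `θ I - A` on its orthogonal complement. -/
noncomputable def shiftedAdjMatrix (r θ : ℝ) : Matrix V V ℝ :=
  Matrix.of fun i j =>
    (if i = j then θ else 0) - G.adjMatrix ℝ i j + (r - θ) / Fintype.card V

theorem shiftedAdjMatrix_mulVec (r θ : ℝ) (x : V → ℝ) :
    G.shiftedAdjMatrix r θ *ᵥ x =
      θ • x - G.adjMatrix ℝ *ᵥ x + fun _ => (r - θ) / Fintype.card V * ∑ i, x i := by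
  funext i
  simp only [Matrix.mulVec, dotProduct, shiftedAdjMatrix, Matrix.of_apply, add_mul, sub_mul,
    Finset.sum_add_distrib, Finset.sum_sub_distrib, ite_mul, zero_mul, Finset.sum_ite_eq,
    Finset.mem_univ, if_true, Finset.mul_sum, Pi.add_apply, Pi.sub_apply, Pi.smul_apply,
    smul_eq_mul]

variable {G}

theorem IsRegularOfDegree.shiftedAdjMatrix_mulVec_one [Nonempty V] {r : ℕ}
    (hr : G.IsRegularOfDegree r) (θ : ℝ) : G.shiftedAdjMatrix r θ *ᵥ 1 = 0 := by
  have hA : G.adjMatrix ℝ *ᵥ 1 = (r : ℝ) • 1 := by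
    funext i
    simpa using adjMatrix_mulVec_const_apply_of_regular (α := ℝ) (a := 1) (v := i) hr
  rw [shiftedAdjMatrix_mulVec, hA]
  funext i
  simp

theorem isHermitian_shiftedAdjMatrix (r θ : ℝ) : (G.shiftedAdjMatrix r θ).IsHermitian := by
  ext i j
  simp [shiftedAdjMatrix, SimpleGraph.adjMatrix_apply, G.adj_comm, eq_comm]

/-- If `θ` bounds the Rayleigh quotient of the adjacency matrix on sum-zero vectors, then the
shifted matrix is positive semidefinite: subtracting from a vector its mean does not change the
value of the quadratic form. -/
theorem IsRegularOfDegree.posSemidef_shiftedAdjMatrix [Nonempty V] {r : ℕ}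
    (hr : G.IsRegularOfDegree r) {θ : ℝ}
    (hθ : ∀ u : V → ℝ, ∑ i, u i = 0 → u ⬝ᵥ G.adjMatrix ℝ *ᵥ u ≤ θ * (u ⬝ᵥ u)) :
    (G.shiftedAdjMatrix r θ).PosSemidef := by
  refine .of_dotProduct_mulVec_nonneg (isHermitian_shiftedAdjMatrix _ _) fun x => ?_
  set M := G.shiftedAdjMatrix r θ with hM
  set m : ℝ := (∑ i, x i) / Fintype.card V with hm
  set u : V → ℝ := x - m • 1 with hu
  have hsum : ∑ i, u i = 0 := by
    simp [hu, hm, Finset.sum_sub_distrib]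
    field_simp
    ring
  have hM1 : M *ᵥ 1 = 0 := hr.shiftedAdjMatrix_mulVec_one θ
  have hM1' : ∀ y : V → ℝ, 1 ⬝ᵥ M *ᵥ y = 0 := fun y => by
    have hT : Mᵀ = M := by simpa using (isHermitian_shiftedAdjMatrix (G := G) (r : ℝ) θ).eq
    rw [dotProduct_mulVec, ← mulVec_transpose, hT, hM1, zero_dotProduct]
  have hx : x = u + m • 1 := by simp [hu]
  have hform : x ⬝ᵥ M *ᵥ x = u ⬝ᵥ M *ᵥ u := by
    conv_lhs => rw [hx]
    rw [mulVec_add, mulVec_smul, hM1, smul_zero, add_zero, add_dotProduct, smul_dotProduct, hM1',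
      smul_zero, add_zero]
  rw [star_trivial, hform, hM, shiftedAdjMatrix_mulVec, hsum]
  have := hθ u hsum
  simp only [mul_zero, dotProduct_add, dotProduct_sub, dotProduct_smul, smul_eq_mul]
  have h0 : u ⬝ᵥ (fun _ => (0 : ℝ)) = 0 := dotProduct_zero u
  rw [h0]
  linarith

/-- At the largest Rayleigh quotient on sum-zero vectors, the shifted matrix has corank at least
two: its kernel contains the all-ones vector and a maximizer. -/
theorem IsRegularOfDegree.rank_shiftedAdjMatrix_add_two_le [Nonempty V] {r : ℕ}
    (hr : G.IsRegularOfDegree r) {v : V → ℝ} (hv : ∑ i, v i = 0) (hv1 : v ⬝ᵥ v = 1)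
    (hM : (G.shiftedAdjMatrix r (v ⬝ᵥ G.adjMatrix ℝ *ᵥ v)).PosSemidef) :
    (G.shiftedAdjMatrix r (v ⬝ᵥ G.adjMatrix ℝ *ᵥ v)).rank + 2 ≤ Fintype.card V := by
  refine Matrix.rank_add_two_le (x := 1) (y := v) ?_ (hr.shiftedAdjMatrix_mulVec_one _) ?_
  · rw [LinearIndependent.pair_iff]
    intro s t h
    have ht : t = 0 := by
      have h' := congrArg (fun y => v ⬝ᵥ y) h
      simpa [dotProduct_add, dotProduct_smul, hv1, dotProduct_one, hv] using h'
    refine ⟨?_, ht⟩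
    have h' := congrFun h (Classical.arbitrary V)
    simpa [ht] using h'
  · rw [← hM.dotProduct_mulVec_zero_iff, star_trivial, shiftedAdjMatrix_mulVec, hv]
    have h0 : v ⬝ᵥ (fun _ => (0 : ℝ)) = 0 := dotProduct_zero v
    simp [dotProduct_add, dotProduct_sub, dotProduct_smul, hv1, h0]

end SimpleGraph

/-! ### From two distances to a spherical representation -/

/-- A placement of the vertices on a sphere with distance `a` between adjacent and a smaller
distance `b > 0` between distinct non-adjacent vertices is a spherical representation, provided
that both distances occur. -/
theorem hasSphericalRepresentation_of_dist {V : Type*} {G : SimpleGraph V} {d : ℕ}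
    {f : V → EuclideanSpace ℝ (Fin d)} {R a b : ℝ} (hR : 0 < R) (hb : 0 < b) (hab : b < a)
    (hnorm : ∀ i, ‖f i‖ = R) (hadj : ∀ i j, G.Adj i j → dist (f i) (f j) = a)
    (hnadj : ∀ i j, i ≠ j → ¬ G.Adj i j → dist (f i) (f j) = b)
    (hea : ∃ i j, G.Adj i j) (heb : ∃ i j, i ≠ j ∧ ¬ G.Adj i j) :
    HasSphericalRepresentation G d := by
  have hinj : Function.Injective f := by
    intro i j h
    by_contra hij
    have h0 : dist (f i) (f j) = 0 := by rw [h, dist_self]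
    by_cases hA : G.Adj i j
    · linarith [hadj i j hA]
    · linarith [hnadj i j hij hA]
  have hset : distanceSet (Set.range f) = {a, b} := by
    ext t
    constructor
    · rintro ⟨_, ⟨i, rfl⟩, _, ⟨j, rfl⟩, hne, rfl⟩
      by_cases hA : G.Adj i j
      · exact Or.inl (hadj i j hA)
      · exact Or.inr (hnadj i j (fun h => hne (h ▸ rfl)) hA)
    · rintro (rfl | rfl)
      · obtain ⟨i, j, h⟩ := hea
        exact ⟨f i, ⟨i, rfl⟩, f j, ⟨j, rfl⟩, hinj.ne h.ne, (hadj i j h).symm⟩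
      · obtain ⟨i, j, hij, h⟩ := heb
        exact ⟨f i, ⟨i, rfl⟩, f j, ⟨j, rfl⟩, hinj.ne hij, (hnadj i j hij h).symm⟩
  have hgreatest : IsGreatest (distanceSet (Set.range f)) a := by
    rw [hset]
    refine ⟨Or.inl rfl, ?_⟩
    rintro t (rfl | rfl)
    · exact le_rfl
    · exact hab.le
  refine ⟨Set.range f, ?_, ⟨0, R, hR, ?_⟩, ⟨⟨Equiv.ofInjective f hinj, ?_⟩⟩⟩
  · rw [IsTwoDistanceSet, hset, Set.ncard_pair hab.ne']
  · rintro _ ⟨i, rfl⟩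
    rw [mem_sphere_zero_iff_norm, hnorm]
  · intro i j
    change _ ≠ _ ∧ IsGreatest _ (dist (f i) (f j)) ↔ _
    rw [(Equiv.ofInjective f hinj).injective.ne_iff]
    constructor
    · rintro ⟨hij, h⟩
      by_contra hA
      have := h.unique hgreatest
      linarith [hnadj i j hij hA]
    · intro h
      exact ⟨h.ne, by rw [hadj i j h]; exact hgreatest⟩

theorem mainTheorem3 {V : Type*} [Fintype V] (G : SimpleGraph V) [DecidableRel G.Adj]
    (d : ℕ) (hcard : Fintype.card V = d + 2)
    (hreg : ∃ r : ℕ, G.IsRegularOfDegree r)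
    (hG : ¬ G.IsCompleteMultipartite) :
    HasSphericalRepresentation G d := by
  classical
  obtain ⟨r, hr⟩ := hreg
  have : Nonempty V := Fintype.card_pos_iff.mp (by omega)
  obtain ⟨w, hw, hwpos⟩ := G.exists_sum_eq_zero_adjMatrix_pos hG
  have hw0 : w ≠ 0 := by
    rintro rfl
    simp at hwpos
  obtain ⟨v, hv, hv1, hmax⟩ := (G.adjMatrix ℝ).exists_isMax_rayleigh_sum_eq_zero hw hw0
  have hM := hr.posSemidef_shiftedAdjMatrix hmax
  have hrank := hr.rank_shiftedAdjMatrix_add_two_le hv hv1 hM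
  set θ := v ⬝ᵥ G.adjMatrix ℝ *ᵥ v
  have hθ : 0 < θ := by
    have hww : 0 < w ⬝ᵥ w := by simpa using Matrix.dotProduct_star_self_pos_iff.mpr hw0
    exact pos_of_mul_pos_left (hwpos.trans_le (hmax w hw)) hww.le
  obtain ⟨f, hf⟩ := hM.exists_inner_eq (d := d) (by omega)
  set s : ℝ := θ + (r - θ) / Fintype.card V with hs_def
  have hdiag : ∀ i, ‖f i‖ ^ 2 = s := fun i => by
    rw [← real_inner_self_eq_norm_sq, hf]
    simp [SimpleGraph.shiftedAdjMatrix, s]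
  have hs : 0 < s := by
    have hc : (1 : ℝ) < Fintype.card V := by exact_mod_cast (by omega : 1 < Fintype.card V)
    have hs' : s = (θ * (Fintype.card V - 1) + r) / Fintype.card V := by
      rw [hs_def]
      field_simp
      ring
    rw [hs']
    have : 0 < θ * ((Fintype.card V : ℝ) - 1) := mul_pos hθ (by linarith)
    positivity
  have hdist : ∀ i j, i ≠ j → dist (f i) (f j) ^ 2 = 2 * θ + 2 * G.adjMatrix ℝ i j := by
    intro i j hij
    rw [dist_eq_norm, norm_sub_sq_real, hdiag, hdiag, hf]
    simp only [SimpleGraph.shiftedAdjMatrix, Matrix.of_apply, if_neg hij, hs_def]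
    ring
  refine hasSphericalRepresentation_of_dist (f := f) (R := √s) (a := √(2 * θ + 2))
    (b := √(2 * θ)) (Real.sqrt_pos.mpr hs) (Real.sqrt_pos.mpr (by positivity))
    (Real.sqrt_lt_sqrt (by positivity) (by linarith)) (fun i => ?_) (fun i j h => ?_)
    (fun i j hij h => ?_) ?_ ?_
  · rw [← hdiag i, Real.sqrt_sq (norm_nonneg _)]
  · rw [← Real.sqrt_sq (dist_nonneg (x := f i) (y := f j)), hdist i j h.ne]
    simp [h]
  · rw [← Real.sqrt_sq (dist_nonneg (x := f i) (y := f j)), hdist i j hij]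
    simp [h]
  · -- An edgeless graph is complete multipartite.
    by_contra! h
    exact hG ⟨fun i _ k _ _ => h i k⟩
  · -- In a complete graph non-adjacency is equality, hence transitive.
    by_contra! h
    refine hG ⟨fun i j k hij hjk => ?_⟩
    have h1 : i = j := by_contra fun hne => hij (h i j hne)
    exact h1 ▸ hjk
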